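/- Let $c$ be the complex Banach space of convergent complex sequences with the supremum norm, let $B=B_c$ be its open unit ball, and let $\overline{B}^{**}$ be the closed unit ball of its bidual $c^{**}$. Let $A_u(B)$ be the algebra of all bounded analytic functions $f:B\to\mathbb{C}$ that are uniformly continuous on $B$, with the supremum norm; it contains the restrictions to $B$ of the functionals in $c^*$. Let $M$ be the spectrum of $A_u(B)$ (the set of nonzero continuous multiplicative linear functionals $\tau:A_u(B)\to\mathbb{C}$), and write $\hat f(\tau)=\tau(f)$ for the Gelfand transform. For $x^{**}\in\overline{B}^{**}$ let $$M_{x^{**}}=\{\tau\in M:\ \tau(x^*|_B)=x^{**}(x^*)\ \text{for all } x^*\in c^*\}$$ be the fiber over $x^{**}$, and for $f\in A_u(B)$ let $Cl_B(f,x^{**})$ be the set of all limits of $f(x_\alpha)$ along nets $(x_\alpha)$ in $B$ that converge weak-star to $x^{**}$. Then $c$ satisfies the cluster value theorem for $A_u(B)$ at every point of $\overline{B}^{**}$, that is, for every $x^{**}\in\overline{B}^{**}$, $$Cl_B(f,x^{**})=\hat f(M_{x^{**}})\qquad\text{for all } f\in A_u(B).$$ Moreover, for every $x^{**}\in\overline{B}^{**}$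 the fiber $M_{x^{**}}$ consists of exactly one point. -/

import Mathlib

open Filter Topology
open scoped ENNReal BoundedContinuousFunction

noncomputable section

namespace ClusterValue

/-- The space `c` of convergent complex sequences, as a subspace of `ℓ^∞` (with the sup norm). -/
def convSeqSubmodule : Submodule ℂ (lp (fun _ : ℕ => ℂ) ∞) where
  carrier := {x | ∃ a : ℂ, Tendsto (fun n => x n) atTop (𝓝 a)}
  zero_mem' := ⟨0, by simp⟩
  add_mem' := by
    rintro x y ⟨a, ha⟩ ⟨b, hb⟩
    exact ⟨a + b, by simpa using ha.add hb⟩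
  smul_mem' := by
    rintro k x ⟨a, ha⟩
    exact ⟨k • a, by simpa using ha.const_mul k⟩

/-- The space `c` as a normed space in its own right. -/
def ConvSeq : Type := convSeqSubmodule

instance : NormedAddCommGroup ConvSeq := inferInstanceAs (NormedAddCommGroup convSeqSubmodule)

instance : NormedSpace ℂ ConvSeq := inferInstanceAs (NormedSpace ℂ convSeqSubmodule)

section General

variable (X : Type*) [NormedAddCommGroup X] [NormedSpace ℂ X]

/-- The open unit ball `B` of `X`. -/
abbrev UnitBall : Type _ := Metric.ball (0 : X) 1

/-- The algebra `A_u(B)` of bounded analytic functions on the open unit ball `B` of `X` that are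
uniformly continuous on `B`, with pointwise operations and the sup norm inherited from `B →ᵇ ℂ`. -/
def Au : Subalgebra ℂ (UnitBall X →ᵇ ℂ) where
  carrier := {f | UniformContinuous f ∧
    ∃ F : X → ℂ, AnalyticOnNhd ℂ F (Metric.ball 0 1) ∧ ∀ x : UnitBall X, f x = F x}
  add_mem' := by
    rintro f g ⟨hf, F, hF, hfF⟩ ⟨hg, G, hG, hgG⟩
    exact ⟨hf.add hg, F + G, hF.add hG, fun x => by simp [hfF, hgG]⟩
  mul_mem' := by
    rintro f g ⟨hf, F, hF, hfF⟩ ⟨hg, G, hG, hgG⟩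
    refine ⟨?_, F * G, hF.mul hG, fun x => by simp [hfF, hgG]⟩
    rw [Metric.uniformContinuous_iff] at hf hg ⊢
    intro ε hε
    have hM : 0 < ‖f‖ + ‖g‖ + 1 := by positivity
    obtain ⟨δ, hδ, h⟩ := hf (ε / (‖f‖ + ‖g‖ + 1)) (div_pos hε hM)
    obtain ⟨η, hη, k⟩ := hg (ε / (‖f‖ + ‖g‖ + 1)) (div_pos hε hM)
    refine ⟨min δ η, lt_min hδ hη, fun a b hab => ?_⟩
    have h1 := h (lt_of_lt_of_le hab (min_le_left _ _))
    have h2 := k (lt_of_lt_of_le hab (min_le_right _ _))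
    rw [dist_eq_norm, lt_div_iff₀ hM] at h1 h2
    rw [dist_eq_norm]
    have e : (f * g) a - (f * g) b = f a * (g a - g b) + (f a - f b) * g b := by
      simp only [BoundedContinuousFunction.coe_mul, Pi.mul_apply]; ring
    rw [e]
    refine (norm_add_le _ _).trans_lt ?_
    rw [norm_mul, norm_mul]
    have hfa := f.norm_coe_le_norm a
    have hgb := g.norm_coe_le_norm b
    have p1 := mul_le_mul_of_nonneg_right hfa (norm_nonneg (g a - g b))
    have p2 := mul_le_mul_of_nonneg_left hgb (norm_nonneg (f a - f b))
    by_contra! hc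
    have q1 : ‖f‖ * (‖g a - g b‖ * (‖f‖ + ‖g‖ + 1)) ≤ ‖f‖ * ε :=
      mul_le_mul_of_nonneg_left h2.le (norm_nonneg _)
    have q2 : ‖g‖ * (‖f a - f b‖ * (‖f‖ + ‖g‖ + 1)) ≤ ‖g‖ * ε :=
      mul_le_mul_of_nonneg_left h1.le (norm_nonneg _)
    have q3 : ε * (‖f‖ + ‖g‖ + 1) ≤
        (‖f‖ * ‖g a - g b‖ + ‖f a - f b‖ * ‖g‖) * (‖f‖ + ‖g‖ + 1) :=
      mul_le_mul_of_nonneg_right (by linarith) hM.le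
    nlinarith
  algebraMap_mem' := fun r =>
    ⟨uniformContinuous_const, fun _ => r, analyticOnNhd_const, fun _ => rfl⟩

variable {X}

/-- The restriction of a functional `φ ∈ X*` to `B`, as a bounded continuous function. -/
def dualRestrict (φ : StrongDual ℂ X) : UnitBall X →ᵇ ℂ :=
  BoundedContinuousFunction.ofNormedAddCommGroup (fun x : UnitBall X => φ x)
    (φ.continuous.comp continuous_subtype_val) ‖φ‖ (fun x =>
      (φ.le_opNorm x).trans (mul_le_of_le_one_right (norm_nonneg _)
        (mem_ball_zero_iff.mp x.2).le))

theorem dualRestrict_mem (φ : StrongDual ℂ X) : dualRestrict φ ∈ Au X :=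
  ⟨φ.uniformContinuous.comp uniformContinuous_subtype_val, φ,
    fun _ _ => φ.analyticAt _, fun _ => rfl⟩

variable (X) in
/-- The inclusion `X* ⊂ A_u(B)`, `φ ↦ φ|_B`, as a continuous linear map. -/
def dualToAu : StrongDual ℂ X →L[ℂ] Au X :=
  LinearMap.mkContinuous
    { toFun := fun φ => ⟨dualRestrict φ, dualRestrict_mem φ⟩
      map_add' := fun _ _ => rfl
      map_smul' := fun _ _ => rfl } 1
    (fun φ => by
      rw [one_mul]
      exact BoundedContinuousFunction.norm_ofNormedAddCommGroup_le _ (norm_nonneg _)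
        (fun x : UnitBall X => (φ.le_opNorm x).trans (mul_le_of_le_one_right (norm_nonneg _)
          (mem_ball_zero_iff.mp x.2).le)))

/-- The projection `π(τ) = τ|_{X*}` from the spectrum of `A_u(B)` to the bidual `X**`. -/
def spectrumProj (τ : WeakDual.characterSpace ℂ (Au X)) : StrongDual ℂ (StrongDual ℂ X) :=
  (WeakDual.CharacterSpace.toCLM τ).comp (dualToAu X)

/-- The fiber `M_z(B) = π⁻¹(z)` of the spectrum of `A_u(B)` over `z ∈ X**`. -/
def fiber (z : StrongDual ℂ (StrongDual ℂ X)) : Set (WeakDual.characterSpace ℂ (Au X)) :=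
  {τ | spectrumProj τ = z}

/-- The cluster set `Cl_B(f, z)`: all limits of values of `f` along nets (here: proper filters)
in `B` that converge weak-star to `z ∈ X**`. -/
def clusterSet (f : Au X) (z : StrongDual ℂ (StrongDual ℂ X)) : Set ℂ :=
  {a | ∃ l : Filter (UnitBall X), l.NeBot ∧
    Tendsto (fun x : UnitBall X =>
      StrongDual.toWeakDual (NormedSpace.inclusionInDoubleDual ℂ X x)) l
      (𝓝 (StrongDual.toWeakDual z)) ∧
    Tendsto (fun x : UnitBall X => (f : UnitBall X →ᵇ ℂ) x) l (𝓝 a)}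

/-- `X` satisfies the cluster value theorem for `A_u(B)` at `z`: the cluster set of every
`f ∈ A_u(B)` at `z` is the image of the fiber over `z` under the Gelfand transform of `f`. -/
def ClusterValueTheoremAt (z : StrongDual ℂ (StrongDual ℂ X)) : Prop :=
  ∀ f : Au X, clusterSet f z = WeakDual.gelfandTransform ℂ (Au X) f '' fiber z

end General

end ClusterValue

end

/-! The functionals in `c*` generate `A_u(B)` as a closed algebra (`mem_of_isClosed_of_dual_mem`),
so a character is determined by its projection to the bidual and each fiber has at most one point.
Over the closed unit ball each fiber is nonempty: Goldstine's theorem provides an ultrafilter on `B`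
converging weak-star to the given point, and limits along it form a character. With one character
per fiber, cluster values and Gelfand values coincide.

For the density, dilation and Taylor expansion reduce to homogeneous polynomials, and these are
uniformly close on the ball to their compositions with the finite-rank projections `proj n`
(`exists_norm_sub_proj_le`). This rests on `tendsto_zero_of_null`: a multilinear form on `c` tends
to zero along bounded, pointwise convergent families as soon as one of them is null on `ℕ ∪ {∞}`. If
all varying arguments are null, a gliding hump selects members whose signed sums stay bounded
however many are taken, while `sum_norm_diag_le` bounds the sum of the corresponding values of the
form. Those values therefore cannot stay away from zero. -/

noncomputable section

namespace ClusterValue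

/-! ### Diagonal sums of multilinear forms. -/

/-- Signs can be chosen so that the diagonal of a square array of complex numbers is dominated by
the signed sum over the whole array. -/
theorem exists_signs_norm_diag_le (b : ℕ → ℕ → ℂ) (N : ℕ) (d : ℂ) :
    ∃ ε : ℕ → ℂ, (∀ k, ‖ε k‖ = 1) ∧
      ‖d + ∑ k ∈ Finset.range N, b k k‖ ≤
        ‖d + ∑ k ∈ Finset.range N, ∑ l ∈ Finset.range N, ε k * ε l * b k l‖ := by
  induction N generalizing d with
  | zero => exact ⟨fun _ => 1, by simp, by simp⟩
  | succ N ih =>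
    -- The free summand `d` exists to absorb the last diagonal term here.
    obtain ⟨ε, hε, h⟩ := ih (d + b N N)
    set X := d + b N N + ∑ k ∈ Finset.range N, ∑ l ∈ Finset.range N, ε k * ε l * b k l with hX
    set Y := ∑ k ∈ Finset.range N, ε k * (b k N + b N k) with hY
    -- The new sign multiplies the cross terms `Y`, while `s * s = 1` leaves `b N N` unchanged. As
    -- `X` is the mean of `X + Y` and `X - Y`, one of these is at least as large in norm.
    have key : ∃ s : ℂ, s * s = 1 ∧ ‖X‖ ≤ ‖X + s * Y‖ := by
      by_contra! hc
      have h1 := hc 1 (by simp)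
      have h2 := hc (-1) (by simp)
      have h3 := norm_add_le (X + 1 * Y) (X + -1 * Y)
      have e : X + 1 * Y + (X + -1 * Y) = 2 * X := by ring
      rw [e, norm_mul, Complex.norm_ofNat] at h3
      linarith
    obtain ⟨s, hs, hsX⟩ := key
    have hs1 : ‖s‖ = 1 := by
      have : ‖s‖ * ‖s‖ = 1 := by rw [← norm_mul, hs, norm_one]
      nlinarith [norm_nonneg s]
    refine ⟨fun k => if k = N then s else ε k, fun k => by dsimp only; split_ifs <;> simp [*], ?_⟩
    have e1 : d + ∑ k ∈ Finset.range (N + 1), b k k =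
        d + b N N + ∑ k ∈ Finset.range N, b k k := by
      rw [Finset.sum_range_succ]; ring
    rw [e1]
    refine (h.trans hsX).trans_eq (congrArg _ ?_)
    have hne : ∀ k ∈ Finset.range N, (if k = N then s else ε k) = ε k := fun k hk =>
      if_neg (Finset.mem_range.mp hk).ne
    rw [Finset.sum_range_succ]
    simp only [Finset.sum_range_succ, if_true, hs, one_mul]
    rw [Finset.sum_add_distrib]
    have e2 : ∑ k ∈ Finset.range N, ∑ l ∈ Finset.range N,
        (if k = N then s else ε k) * (if l = N then s else ε l) * b k l =
        ∑ k ∈ Finset.range N, ∑ l ∈ Finset.range N, ε k * ε l * b k l :=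
      Finset.sum_congr rfl fun k hk => Finset.sum_congr rfl fun l hl => by rw [hne k hk, hne l hl]
    have e3 : ∑ k ∈ Finset.range N, (if k = N then s else ε k) * s * b k N =
        s * ∑ k ∈ Finset.range N, ε k * b k N := by
      rw [Finset.mul_sum]
      exact Finset.sum_congr rfl fun k hk => by rw [hne k hk]; ring
    have e4 : ∑ l ∈ Finset.range N, s * (if l = N then s else ε l) * b N l =
        s * ∑ k ∈ Finset.range N, ε k * b N k := by
      rw [Finset.mul_sum]
      exact Finset.sum_congr rfl fun k hk => by rw [hne k hk]; ring
    rw [e2, e3, e4, hX, hY]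
    simp only [mul_add, Finset.sum_add_distrib]
    ring

section Multilinear

variable {E ι : Type*} [NormedAddCommGroup E] [NormedSpace ℂ E] [DecidableEq ι]

theorem map_update_sum_smul (A : ContinuousMultilinearMap ℂ (fun _ : ι => E) ℂ) (m : ι → E)
    (i : ι) (t : Finset ℕ) (c : ℕ → ℂ) (g : ℕ → E) :
    A (Function.update m i (∑ k ∈ t, c k • g k)) =
      ∑ k ∈ t, c k * A (Function.update m i (g k)) := by
  refine (A.toMultilinearMap.map_update_sum t i _ m).trans (Finset.sum_congr rfl fun k _ => ?_)
  exact A.map_update_smul m i (c k) (g k)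

variable [Fintype ι]

/-- If all signed sums of the sequences `v i` are bounded by `R`, then so are, up to the norm of
the form, the diagonal sums of a multilinear form. -/
theorem norm_sum_diag_le (A : ContinuousMultilinearMap ℂ (fun _ : ι => E) ℂ) (v : ι → ℕ → E)
    (N : ℕ) {R : ℝ} (i₀ : ι) (T : Finset ι) (hi₀ : i₀ ∉ T)
    (hv : ∀ i ∈ insert i₀ T, ∀ t : ℕ → ℂ, (∀ k, ‖t k‖ ≤ 1) →
      ‖∑ k ∈ Finset.range N, t k • v i k‖ ≤ R)
    (W : ι → E) (hW : ∀ i, ‖W i‖ ≤ R) (s : ℕ → ℂ) (hs : ∀ k, ‖s k‖ ≤ 1) :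
    ‖∑ k ∈ Finset.range N, s k * A (fun i => if i ∈ insert i₀ T then v i k else W i)‖ ≤
      ‖A‖ * R ^ Fintype.card ι := by
  induction T using Finset.induction_on generalizing W s with
  | empty =>
    have e : ∑ k ∈ Finset.range N,
        s k * A (fun i => if i ∈ insert i₀ (∅ : Finset ι) then v i k else W i) =
        A (Function.update W i₀ (∑ k ∈ Finset.range N, s k • v i₀ k)) := by
      rw [map_update_sum_smul]
      refine Finset.sum_congr rfl fun k _ => ?_
      congr 2
      ext i
      by_cases h : i = i₀
      · subst h; simp
      · simp [h]
    rw [e]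
    refine (A.le_opNorm_mul_prod_of_le (b := fun _ => R) fun i => ?_).trans_eq (by simp)
    by_cases h : i = i₀
    · subst h; simpa using hv i (by simp) s hs
    · simpa [h] using hW i
  | insert j T hj ih =>
    have hji : j ≠ i₀ := fun h => hi₀ (by simp [h])
    have hiT : i₀ ∉ T := fun h => hi₀ (Finset.mem_insert_of_mem h)
    have hj' : j ∉ insert i₀ T := by simp [hji, hj]
    set u : ℕ → ι → E := fun k i => if i ∈ insert i₀ T then v i k else W i with hu
    -- Passing to the double sum decouples slot `j` from `k`: it receives the fixed vector `∑ ε l •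
    -- v j l`, of norm at most `R`, and the signs `ε k` join the coefficients `s k`. Hence the
    -- arbitrary `W` and `s`.
    obtain ⟨ε, hε, h⟩ := exists_signs_norm_diag_le
      (fun k l => s k * A (Function.update (u k) j (v j l))) N 0
    have e1 : ∀ k, A (fun i => if i ∈ insert i₀ (insert j T) then v i k else W i) =
        A (Function.update (u k) j (v j k)) := fun k => by
      congr 1
      ext i
      by_cases h : i = j
      · subst h; simp
      · simp [h, hu]
    have e2 : ∑ k ∈ Finset.range N, ∑ l ∈ Finset.range N,
        ε k * ε l * (s k * A (Function.update (u k) j (v j l))) =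
        ∑ k ∈ Finset.range N, (s k * ε k) * A (fun i => if i ∈ insert i₀ T then v i k else
          Function.update W j (∑ l ∈ Finset.range N, ε l • v j l) i) := by
      refine Finset.sum_congr rfl fun k _ => ?_
      have e3 : (fun i => if i ∈ insert i₀ T then v i k else
          Function.update W j (∑ l ∈ Finset.range N, ε l • v j l) i) =
          Function.update (u k) j (∑ l ∈ Finset.range N, ε l • v j l) := by
        ext i
        by_cases h : i = j
        · subst h; simp [hj']
        · simp [h, hu]
      rw [e3, map_update_sum_smul, Finset.mul_sum]
      exact Finset.sum_congr rfl fun l _ => by ring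
    simp only [zero_add] at h
    simp only [e1]
    refine h.trans ?_
    rw [e2]
    refine ih hiT (fun i hi => hv i ?_) _ (fun i => ?_) _ (fun k => ?_)
    · rw [Finset.insert_comm]
      exact Finset.mem_insert_of_mem hi
    · by_cases h : i = j
      · subst h; simpa using hv i (by simp) ε fun k => (hε k).le
      · simpa [h] using hW i
    · rw [norm_mul, hε, mul_one]; exact hs k

/-- The coefficients `s k` are taken to be phases that turn each term into its norm; if a term is
zero, its phase is `0` by the convention for division, which `‖s k‖ ≤ 1` allows. -/
theorem sum_norm_diag_le (A : ContinuousMultilinearMap ℂ (fun _ : ι => E) ℂ) (v : ι → ℕ → E)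
    (N : ℕ) {R : ℝ} (i₀ : ι) (T : Finset ι) (hi₀ : i₀ ∉ T)
    (hv : ∀ i ∈ insert i₀ T, ∀ t : ℕ → ℂ, (∀ k, ‖t k‖ ≤ 1) →
      ‖∑ k ∈ Finset.range N, t k • v i k‖ ≤ R)
    (W : ι → E) (hW : ∀ i, ‖W i‖ ≤ R) :
    ∑ k ∈ Finset.range N, ‖A (fun i => if i ∈ insert i₀ T then v i k else W i)‖ ≤
      ‖A‖ * R ^ Fintype.card ι := by
  set a : ℕ → ℂ := fun k => A (fun i => if i ∈ insert i₀ T then v i k else W i) with ha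
  have h := norm_sum_diag_le A v N i₀ T hi₀ hv W hW
    (fun k => (‖a k‖ : ℂ) / a k) (fun k => by
      rw [norm_div, Complex.norm_real, norm_norm]; exact div_self_le_one _)
  refine le_trans (le_of_eq ?_) h
  have e : ∀ k, (‖a k‖ : ℂ) / a k * a k = (‖a k‖ : ℂ) := fun k => by
    by_cases h : a k = 0
    · simp [h]
    · exact div_mul_cancel₀ _ h
  change _ = ‖∑ k ∈ Finset.range N, (‖a k‖ : ℂ) / a k * a k‖
  simp only [e]
  rw [← Complex.ofReal_sum, Complex.norm_real, Real.norm_of_nonneg]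
  exact Finset.sum_nonneg fun _ _ => norm_nonneg _

end Multilinear

/-! ### Terms, limit and finite-rank projections on `c`. -/

namespace ConvSeq

/-- The convergent sequence with given terms. -/
def mk (x : ℕ → ℂ) (h : ∃ a, Tendsto x atTop (𝓝 a)) : ConvSeq :=
  (⟨⟨x, memℓp_infty h.choose_spec.norm.bddAbove_range⟩, h⟩ : convSeqSubmodule)

/-- The `n`-th term, as a functional on `c`. -/
def coord (n : ℕ) : StrongDual ℂ ConvSeq :=
  LinearMap.mkContinuous
    { toFun := fun x : convSeqSubmodule => x.1 n
      map_add' := fun _ _ => rfl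
      map_smul' := fun _ _ => rfl } 1
    (fun x => by
      rw [one_mul]
      exact lp.norm_apply_le_norm ENNReal.top_ne_zero (x : convSeqSubmodule).1 n)

theorem norm_coord_le (n : ℕ) (x : ConvSeq) : ‖coord n x‖ ≤ ‖x‖ :=
  lp.norm_apply_le_norm ENNReal.top_ne_zero (x : convSeqSubmodule).1 n

theorem norm_le_of_forall_coord {x : ConvSeq} {R : ℝ} (hR : 0 ≤ R) (h : ∀ n, ‖coord n x‖ ≤ R) :
    ‖x‖ ≤ R :=
  lp.norm_le_of_forall_le hR h

theorem exists_tendsto_coord (x : ConvSeq) : ∃ a, Tendsto (fun n => coord n x) atTop (𝓝 a) :=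
  (x : convSeqSubmodule).2

/-- The limit, as a functional on `c`. -/
def limit : StrongDual ℂ ConvSeq :=
  LinearMap.mkContinuous
    { toFun := fun x => (exists_tendsto_coord x).choose
      map_add' := fun x y => tendsto_nhds_unique (exists_tendsto_coord (x + y)).choose_spec <| by
        simpa only [map_add] using
          (exists_tendsto_coord x).choose_spec.add (exists_tendsto_coord y).choose_spec
      map_smul' := fun r x => tendsto_nhds_unique (exists_tendsto_coord (r • x)).choose_spec <| by
        simpa only [map_smul, RingHom.id_apply] using
          (exists_tendsto_coord x).choose_spec.const_smul r } 1
    (fun x => by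
      rw [one_mul]
      exact le_of_tendsto (exists_tendsto_coord x).choose_spec.norm
        (Eventually.of_forall fun n => norm_coord_le n x))

theorem tendsto_coord (x : ConvSeq) : Tendsto (fun n => coord n x) atTop (𝓝 (limit x)) :=
  (exists_tendsto_coord x).choose_spec

theorem norm_limit_le (x : ConvSeq) : ‖limit x‖ ≤ ‖x‖ :=
  le_of_tendsto (tendsto_coord x).norm (Eventually.of_forall fun n => norm_coord_le n x)

/-- The terms and the limit: evaluation at the points of `ℕ ∪ {∞}`. -/
def eval : Option ℕ → StrongDual ℂ ConvSeq
  | none => limit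
  | some n => coord n

theorem norm_eval_le (o : Option ℕ) (x : ConvSeq) : ‖eval o x‖ ≤ ‖x‖ := by
  cases o with
  | none => exact norm_limit_le x
  | some n => exact norm_coord_le n x

/-- The vectors spanning the range of the projection `proj n`. -/
def projBasis (n : ℕ) : Option (Fin n) → ConvSeq
  | none => mk (fun j => if j < n then 0 else 1) ⟨1, tendsto_const_nhds.congr' <|
      (eventually_ge_atTop n).mono fun _ hj => (if_neg (not_lt.mpr hj)).symm⟩
  | some i => mk (fun j => if j = i then 1 else 0) ⟨0, tendsto_const_nhds.congr' <|
      (eventually_gt_atTop (i : ℕ)).mono fun _ hj => (if_neg hj.ne').symm⟩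

/-- The projection of `c` that replaces all terms from the `n`-th on by the limit. -/
def proj (n : ℕ) (x : ConvSeq) : ConvSeq :=
  ∑ o : Option (Fin n), eval (o.map Fin.val) x • projBasis n o

theorem coord_proj (n j : ℕ) (x : ConvSeq) :
    coord j (proj n x) = if j < n then coord j x else limit x := by
  have e : coord j (proj n x) = limit x * (if j < n then 0 else 1) +
      ∑ i : Fin n, coord i x * (if j = i then 1 else 0) := by
    rw [proj, map_sum, Fintype.sum_option]
    simp only [map_smul]
    rfl
  rw [e]
  split_ifs with h
  · rw [Finset.sum_eq_single ⟨j, h⟩]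
    · simp
    · intro i _ hi
      rw [if_neg fun e : j = i => hi (Fin.ext e.symm), mul_zero]
    · simp
  · rw [Finset.sum_eq_zero fun i _ => by
      rw [if_neg fun e : j = i => h (by rw [e]; exact i.2), mul_zero]]
    simp

theorem limit_proj (n : ℕ) (x : ConvSeq) : limit (proj n x) = limit x :=
  tendsto_nhds_unique (tendsto_coord _) <| tendsto_const_nhds.congr' <|
    (eventually_ge_atTop n).mono fun j hj =>
      ((coord_proj n j x).trans (if_neg (not_lt.mpr hj))).symm

theorem norm_proj_le (n : ℕ) (x : ConvSeq) : ‖proj n x‖ ≤ ‖x‖ := by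
  refine norm_le_of_forall_coord (norm_nonneg x) fun j => ?_
  rw [coord_proj]
  split_ifs
  exacts [norm_coord_le j x, norm_limit_le x]

/-- The difference vanishes at `∞` for every `n`, and at `j` once `n > j`; its norm need not tend to
zero. -/
theorem tendsto_eval_sub_proj (x : ℕ → ConvSeq) (o : Option ℕ) :
    Tendsto (fun n => eval o (x n - proj n (x n))) atTop (𝓝 0) := by
  refine tendsto_const_nhds.congr' ?_
  cases o with
  | none => exact Eventually.of_forall fun n => by simp [eval, limit_proj]
  | some j =>
    exact (eventually_gt_atTop j).mono fun n hn => by simp [eval, coord_proj, hn]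

end ConvSeq

open ConvSeq

/-! ### The gliding hump. -/

/-- Gliding hump: from families in `c` that tend to zero at every point of `ℕ ∪ {∞}` one can
select finite sequences of any length that are uniformly absolutely summable. -/
theorem exists_selection {α κ : Type*} {l : Filter α} (S : Finset κ) (w : κ → α → ConvSeq)
    {K : ℝ} (hK : ∀ i a, ‖w i a‖ ≤ K)
    (hw : ∀ i ∈ S, ∀ o, Tendsto (fun a => eval o (w i a)) l (𝓝 0)) {Q : α → Prop}
    (hQ : ∃ᶠ a in l, Q a) (N : ℕ) :
    ∃ a : ℕ → α, (∀ k < N, Q (a k)) ∧ ∀ i ∈ S,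
      (∀ n, ∑ k ∈ Finset.range N, ‖coord n (w i (a k))‖ ≤ K + 1 - (1 / 2) ^ (N + 1)) ∧
      ∑ k ∈ Finset.range N, ‖limit (w i (a k))‖ < 1 - (1 / 2) ^ (N + 1) := by
  induction N with
  | zero =>
    obtain ⟨a, -⟩ := hQ.exists
    refine ⟨fun _ => a, by simp, fun i _ => ⟨fun n => ?_, by norm_num⟩⟩
    have := (norm_nonneg _).trans (hK i a)
    norm_num
    linarith
  | succ N ih =>
    obtain ⟨a, haQ, ha⟩ := ih
    set η : ℝ := (1 / 2) ^ (N + 2) with hη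
    have hη0 : 0 < η := by positivity
    have hη2 : (1 / 2 : ℝ) ^ (N + 1) = 2 * η := by rw [hη, pow_succ _ (N + 1)]; ring
    rw [hη2] at ha
    -- Beyond `n₀` the old sum is below `1 - 2 * η` and the new member adds at most `K`; before `n₀`
    -- and at the limit the new member adds less than `η`. Either way the slack shrinks only from `2
    -- * η` to `η`.
    have h1 : ∀ᶠ n in atTop, ∀ i ∈ S,
        ∑ k ∈ Finset.range N, ‖coord n (w i (a k))‖ < 1 - 2 * η :=
      (Finset.eventually_all S).mpr fun i hi =>
        (tendsto_finsetSum _ fun k _ => (tendsto_coord (w i (a k))).norm).eventually_lt_const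
          (ha i hi).2
    obtain ⟨n₀, hn₀⟩ := eventually_atTop.mp h1
    have h2 : ∀ i ∈ S, ∀ o, ∀ᶠ x in l, ‖eval o (w i x)‖ < η := fun i hi o => by
      have := (hw i hi o).norm
      rw [norm_zero] at this
      exact this.eventually_lt_const hη0
    have h3 : ∀ᶠ x in l, ∀ i ∈ S, (∀ n ∈ Finset.range n₀, ‖coord n (w i x)‖ < η) ∧
        ‖limit (w i x)‖ < η :=
      (Finset.eventually_all S).mpr fun i hi =>
        ((Finset.eventually_all _).mpr fun n _ => h2 i hi (some n)).and (h2 i hi none)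
    obtain ⟨x, hxQ, hx⟩ := (hQ.and_eventually h3).exists
    have hne : ∀ k ∈ Finset.range N, Function.update a N x k = a k := fun k hk =>
      Function.update_of_ne (Finset.mem_range.mp hk).ne _ _
    refine ⟨Function.update a N x, fun k hk => ?_, fun i hi => ⟨fun n => ?_, ?_⟩⟩
    · rcases Nat.lt_succ_iff_lt_or_eq.mp hk with h | h
      · rw [hne k (Finset.mem_range.mpr h)]; exact haQ k h
      · subst h; simpa using hxQ
    · rw [Finset.sum_range_succ, Function.update_self,
        Finset.sum_congr rfl fun k hk => by rw [hne k hk]]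
      by_cases hn : n < n₀
      · linarith [(ha i hi).1 n, (hx i hi).1 n (Finset.mem_range.mpr hn)]
      · linarith [hn₀ n (not_lt.mp hn) i hi, norm_coord_le n (w i x), hK i x]
    · rw [Finset.sum_range_succ, Function.update_self,
        Finset.sum_congr rfl fun k hk => by rw [hne k hk]]
      linarith [(ha i hi).2, (hx i hi).2]

/-! ### Multilinear forms along pointwise convergent families. -/

section Multilinear

variable {ι : Type*} [Fintype ι] [DecidableEq ι]
  (A : ContinuousMultilinearMap ℂ (fun _ : ι => ConvSeq) ℂ)

/-- Otherwise `N` members with values of norm at least `ε` can be selected by the gliding hump. The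
diagonal estimate gives `N * ε ≤ ‖A‖ * (K + 1) ^ card ι`, with a right side independent of `N`. -/
theorem tendsto_zero_of_null_or_const {α : Type*} {l : Filter α} (w : ι → α → ConvSeq) {K : ℝ}
    (hK : ∀ i a, ‖w i a‖ ≤ K) {i₀ : ι} {T : Finset ι} (hi₀ : i₀ ∉ T)
    (hT : ∀ i ∈ insert i₀ T, ∀ o, Tendsto (fun a => eval o (w i a)) l (𝓝 0))
    (hc : ∀ i ∉ insert i₀ T, ∃ W, ∀ a, w i a = W) :
    Tendsto (fun a => A (fun i => w i a)) l (𝓝 0) := by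
  rw [Metric.tendsto_nhds]
  by_contra! hcon
  obtain ⟨ε, hε, hfreq⟩ := hcon
  have hfreq : ∃ᶠ a in l, ε ≤ ‖A (fun i => w i a)‖ := by simpa using hfreq
  obtain ⟨a₀, -⟩ := hfreq.exists
  obtain ⟨N, hN⟩ := exists_nat_gt (‖A‖ * (K + 1) ^ Fintype.card ι / ε)
  obtain ⟨a, ha, hsum⟩ := exists_selection (insert i₀ T) w hK hT hfreq N
  have hK0 : 0 ≤ K := (norm_nonneg _).trans (hK i₀ a₀)
  have hpow : (0 : ℝ) < (1 / 2) ^ (N + 1) := by positivity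
  have hle := sum_norm_diag_le A (fun i k => w i (a k)) N (R := K + 1) i₀ T hi₀
    (fun i hi t ht => norm_le_of_forall_coord (by linarith) fun n => by
      rw [map_sum]
      refine (norm_sum_le _ _).trans (le_trans (Finset.sum_le_sum fun k _ => ?_)
        (((hsum i hi).1 n).trans (by linarith)))
      rw [map_smul, norm_smul]
      exact mul_le_of_le_one_left (norm_nonneg _) (ht k))
    (fun i => w i a₀) (fun i => (hK i a₀).trans (by linarith))
  have heq : ∀ k, (fun i => if i ∈ insert i₀ T then w i (a k) else w i a₀) =
      fun i => w i (a k) := fun k => by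
    ext1 i
    split_ifs with h
    · rfl
    · obtain ⟨W, hW⟩ := hc i h
      rw [hW, hW]
  simp only [heq] at hle
  have hge : (N : ℝ) * ε ≤ ∑ k ∈ Finset.range N, ‖A (fun i => w i (a k))‖ := by
    simpa using Finset.card_nsmul_le_sum (Finset.range N) _ ε
      fun k hk => ha k (Finset.mem_range.mp hk)
  rw [div_lt_iff₀ hε] at hN
  linarith

/-- A multilinear form on `c` tends to zero along bounded families that converge at every point
of `ℕ ∪ {∞}`, if at least one of them tends to zero there. -/
theorem tendsto_zero_of_null {i₀ : ι} (S : Finset ι) (hi₀ : i₀ ∉ S) {α : Type} {l : Filter α}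
    (w : ι → α → ConvSeq) {K : ℝ} (hK : ∀ i a, ‖w i a‖ ≤ K)
    (h₀ : ∀ o, Tendsto (fun a => eval o (w i₀ a)) l (𝓝 0))
    (hc : ∀ i ∉ S, (∀ o, Tendsto (fun a => eval o (w i a)) l (𝓝 0)) ∨ ∃ W, ∀ a, w i a = W)
    (hS : ∀ i ∈ S, ∀ o, ∃ L, Tendsto (fun a => eval o (w i a)) l (𝓝 L)) :
    Tendsto (fun a => A (fun i => w i a)) l (𝓝 0) := by
  classical
  -- The induction removes the slots that merely converge. It passes to pairs of indices and to
  -- differences, so the index type and the bound must vary.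
  induction S using Finset.induction_on generalizing α K with
  | empty =>
    refine tendsto_zero_of_null_or_const A w hK (i₀ := i₀) (T := Finset.univ.filter
      fun i => i ≠ i₀ ∧ ∀ o, Tendsto (fun a => eval o (w i a)) l (𝓝 0)) (by simp) ?_ ?_
    · intro i hi
      simp only [Finset.mem_insert, Finset.mem_filter, Finset.mem_univ, true_and] at hi
      rcases hi with rfl | hi
      exacts [h₀, hi.2]
    · intro i hi
      simp only [Finset.mem_insert, Finset.mem_filter, Finset.mem_univ, true_and, not_or,
        not_and] at hi
      exact (hc i (by simp)).resolve_left (hi.2 hi.1)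
  | insert j S hj ih =>
    have hji : i₀ ≠ j := fun h => hi₀ (by simp [h])
    have hiS : i₀ ∉ S := fun h => hi₀ (Finset.mem_insert_of_mem h)
    rcases l.eq_or_neBot with rfl | hl
    · exact tendsto_bot
    have fst : Tendsto (Prod.fst : α × α → α) (l.curry l) l := tendsto_fst.mono_left curry_le_prod
    have snd : Tendsto (Prod.snd : α × α → α) (l.curry l) l := tendsto_snd.mono_left curry_le_prod
    have hfix : ∀ b, Tendsto (fun a => A (Function.update (fun i => w i a) j (w j b))) l (𝓝 0) := by
      intro b
      have e : ∀ a, Function.update (fun i => w i a) j (w j b) =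
          fun i => Function.update w j (fun _ => w j b) i a := fun a => by
        ext1 i
        by_cases h : i = j
        · subst h; simp
        · simp [h]
      simp only [e]
      refine ih hiS (Function.update w j fun _ => w j b) (K := K) (fun i a => ?_) ?_
        (fun i hi => ?_) (fun i hi => ?_)
      · by_cases h : i = j
        · subst h; simpa using hK i b
        · simpa [h] using hK i a
      · simpa [hji] using h₀
      · by_cases h : i = j
        · subst h; exact Or.inr ⟨w i b, by simp⟩
        · simpa [h] using hc i (by simp [h, hi])
      · have h : i ≠ j := fun h => hj (h ▸ hi)
        simpa [h] using hS i (Finset.mem_insert_of_mem hi)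
    -- Slot `j` is split as `(w j a - w j b) + w j b`. The second part is constant in `a`; the first
    -- is null along pairs `(b, a)`, since the values of `w j` converge. The iterated filter allows
    -- `b` to be fixed before `a` moves.
    have hdiff : Tendsto (fun p : α × α =>
        A (Function.update (fun i => w i p.2) j (w j p.2 - w j p.1))) (l.curry l) (𝓝 0) := by
      have e : ∀ p : α × α, Function.update (fun i => w i p.2) j (w j p.2 - w j p.1) =
          fun i => Function.update (fun i (p : α × α) => w i p.2) j
            (fun p => w j p.2 - w j p.1) i p := fun p => by
        ext1 i
        by_cases h : i = j
        · subst h; simp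
        · simp [h]
      simp only [e]
      refine ih hiS (Function.update (fun i (p : α × α) => w i p.2) j
        fun p => w j p.2 - w j p.1) (K := K + K) (fun i p => ?_) ?_ (fun i hi => ?_)
        (fun i hi => ?_)
      · by_cases h : i = j
        · subst h
          simpa using (norm_sub_le _ _).trans (add_le_add (hK i p.2) (hK i p.1))
        · have := (norm_nonneg _).trans (hK i p.2)
          simpa [h] using (hK i p.2).trans (by linarith)
      · simpa [hji, Function.comp_def] using fun o => (h₀ o).comp snd
      · by_cases h : i = j
        · subst h
          refine Or.inl fun o => ?_
          obtain ⟨L, hL⟩ := hS i (Finset.mem_insert_self _ _) o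
          simpa using (hL.comp snd).sub (hL.comp fst)
        · rcases hc i (by simp [h, hi]) with h' | ⟨W, hW⟩
          · exact Or.inl fun o => by simpa [h, Function.comp_def] using (h' o).comp snd
          · exact Or.inr ⟨W, fun p => by simpa [h] using hW p.2⟩
      · have h : i ≠ j := fun h => hj (h ▸ hi)
        intro o
        obtain ⟨L, hL⟩ := hS i (Finset.mem_insert_of_mem hi) o
        exact ⟨L, by simpa [h, Function.comp_def] using hL.comp snd⟩
    rw [Metric.tendsto_nhds]
    intro ε hε
    have h1 := (Metric.tendsto_nhds.mp hdiff) (ε / 2) (half_pos hε)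
    obtain ⟨b, hb⟩ := (eventually_curry_iff.mp h1).exists
    filter_upwards [hb, (Metric.tendsto_nhds.mp (hfix b)) (ε / 2) (half_pos hε)] with a ha ha'
    rw [dist_zero_right] at ha ha' ⊢
    have e : A (fun i => w i a) = A (Function.update (fun i => w i a) j (w j a - w j b)) +
        A (Function.update (fun i => w i a) j (w j b)) := by
      rw [← A.map_update_add, sub_add_cancel, Function.update_eq_self]
    rw [e]
    linarith [norm_add_le (A (Function.update (fun i => w i a) j (w j a - w j b)))
      (A (Function.update (fun i => w i a) j (w j b)))]

/-- A bounded family in `c` converges at each point of `ℕ ∪ {∞}` along an ultrafilter. -/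
theorem exists_tendsto_eval {α : Type*} (l : Ultrafilter α) {x : α → ConvSeq} {K : ℝ}
    (hx : ∀ a, ‖x a‖ ≤ K) (o : Option ℕ) :
    ∃ L, Tendsto (fun a => eval o (x a)) l (𝓝 L) := by
  obtain ⟨L, -, hL⟩ := (isCompact_closedBall (0 : ℂ) K).ultrafilter_le_nhds
    (l.map fun a => eval o (x a)) (le_principal_iff.mpr (mem_map.mpr (Eventually.of_forall fun a => by
      simpa using (norm_eval_le o (x a)).trans (hx a))))
  exact ⟨L, hL⟩

/-- Multilinear forms on `c` are uniformly approximated on the ball by their compositions with the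
finite-rank projections `proj n`. -/
theorem exists_norm_sub_proj_le {ε : ℝ} (hε : 0 < ε) :
    ∃ n, ∀ x : ConvSeq, ‖x‖ ≤ 1 → ‖A (fun _ => x) - A (fun _ => proj n x)‖ ≤ ε := by
  by_contra! hcon
  choose x hx hxε using hcon
  -- The `x n` need not converge pointwise; a free ultrafilter forces convergence at every point of
  -- `ℕ ∪ {∞}` without extracting subsequences.
  set l : Ultrafilter ℕ := hyperfilter ℕ with hl
  -- The slots are projected one at a time, so that each successive difference carries the null
  -- family `x n - proj n (x n)` in one slot.
  have key : ∀ S : Finset ι, Tendsto (fun n => A (fun _ => x n) -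
      A (fun i => if i ∈ S then proj n (x n) else x n)) l (𝓝 0) := by
    intro S
    induction S using Finset.induction_on with
    | empty => simp
    | insert j S hj ih =>
      set w : ι → ℕ → ConvSeq := fun i n => if i = j then x n - proj n (x n) else
        if i ∈ S then proj n (x n) else x n with hw
      have hK : ∀ i n, ‖w i n‖ ≤ 1 + 1 := fun i n => by
        have h1 := (norm_proj_le n (x n)).trans (hx n)
        have h2 := hx n
        simp only [hw]
        split_ifs
        · exact (norm_sub_le _ _).trans (add_le_add h2 h1)
        · linarith
        · linarith
      have h0 : ∀ o, Tendsto (fun n => eval o (w j n)) l (𝓝 0) := fun o => by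
        simpa [hw] using (tendsto_eval_sub_proj x o).mono_left Nat.hyperfilter_le_atTop
      have := tendsto_zero_of_null A (Finset.univ.erase j) (Finset.notMem_erase j _) w hK h0
        (fun i hi => Or.inl (by
          have : i = j := by simpa using hi
          rw [this]; exact h0))
        (fun i _ o => exists_tendsto_eval l (hK i) o)
      have h2 := ih.add this
      rw [add_zero] at h2
      refine h2.congr fun n => ?_
      have e1 : (fun i => w i n) = Function.update (fun i => if i ∈ S then proj n (x n) else x n) j
          (x n - proj n (x n)) := by
        ext1 i
        by_cases h : i = j
        · subst h; simp [hw]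
        · simp [hw, h]
      have e2 : Function.update (fun i => if i ∈ S then proj n (x n) else x n) j (x n) =
          fun i => if i ∈ S then proj n (x n) else x n := by
        rw [Function.update_eq_iff]
        simp [hj]
      have e3 : Function.update (fun i => if i ∈ S then proj n (x n) else x n) j (proj n (x n)) =
          fun i => if i ∈ insert j S then proj n (x n) else x n := by
        ext1 i
        by_cases h : i = j
        · subst h; simp
        · simp [h]
      rw [e1, A.map_update_sub, e2, e3]
      ring
  have h := (Metric.tendsto_nhds.mp (key Finset.univ)) ε hε
  obtain ⟨n, hn⟩ := h.exists
  simp only [Finset.mem_univ, if_true, dist_zero_right] at hn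
  exact (hxε n).not_gt hn

end Multilinear

/-! ### Taylor approximation and evaluations. -/

section General

variable {X : Type*} [NormedAddCommGroup X] [NormedSpace ℂ X]

/-- Cauchy estimates: the Taylor series at the origin of a bounded analytic function on the unit
ball converges uniformly on smaller balls. -/
theorem norm_taylor_sub_le {F : X → ℂ} (hF : AnalyticOnNhd ℂ F (Metric.ball 0 1)) {C : ℝ}
    (hC : ∀ y ∈ Metric.ball (0 : X) 1, ‖F y‖ ≤ C) {p : FormalMultilinearSeries ℂ X ℂ}
    (hp : HasFPowerSeriesAt F p 0) {r ρ : ℝ} (hr : 0 ≤ r) (hrρ : r < ρ) (hρ : ρ < 1) {x : X}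
    (hx : ‖x‖ ≤ 1) (M : ℕ) :
    ‖∑ m ∈ Finset.range M, (r : ℂ) ^ m * p m (fun _ => x) - F ((r : ℂ) • x)‖ ≤
      C * (r / ρ) ^ M / (1 - r / ρ) := by
  have hρ0 : 0 < ρ := hr.trans_lt hrρ
  lift ρ to NNReal using hρ0.le
  -- On the complex line through `x` the estimate is the one-variable Cauchy bound on the circle of
  -- radius `ρ`; uniqueness of power series identifies the coefficients with `p n` on the diagonal.
  set g : ℂ → ℂ := fun t => F (t • x) with hg
  have hball : ∀ t : ℂ, ‖t‖ < 1 → t • x ∈ Metric.ball (0 : X) 1 := fun t ht => by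
    rw [mem_ball_zero_iff, norm_smul]
    exact (mul_le_of_le_one_right (norm_nonneg t) hx).trans_lt ht
  have hdiff : DifferentiableOn ℂ g (Metric.closedBall 0 ρ) := fun t ht => by
    have ht : ‖t‖ < 1 := (mem_closedBall_zero_iff.mp ht).trans_lt hρ
    have h1 : DifferentiableAt ℂ F (t • x) := (hF _ (hball t ht)).differentiableAt
    exact (h1.comp t (differentiableAt_id.smul_const x)).differentiableWithinAt
  have hq := hdiff.hasFPowerSeriesOnBall hρ0
  set u : ℂ →L[ℂ] X := ContinuousLinearMap.toSpanSingleton ℂ x with hu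
  have hp' : HasFPowerSeriesAt g (p.compContinuousLinearMap u) 0 :=
    HasFPowerSeriesAt.compContinuousLinearMap (u := u) (x := 0) (by rwa [map_zero])
  have hpq := hq.hasFPowerSeriesAt.eq_formalMultilinearSeries hp'
  have hcoef : ∀ n, cauchyPowerSeries g 0 ρ n (fun _ => (r : ℂ)) =
      (r : ℂ) ^ n * p n (fun _ => x) := fun n => by
    rw [hpq, FormalMultilinearSeries.compContinuousLinearMap_apply]
    have e : (u ∘ fun _ : Fin n => (r : ℂ)) = fun i : Fin n => (r : ℂ) • x := by
      ext i
      simp [hu]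
    rw [e, (p n).map_smul_univ (fun _ => (r : ℂ)) (fun _ => x)]
    simp
  have hsum := hq.hasSum (y := (r : ℂ)) (by
    rw [Metric.eball_coe, mem_ball_zero_iff, Complex.norm_real, Real.norm_of_nonneg hr]
    exact hrρ)
  simp only [hcoef, zero_add] at hsum
  refine norm_sub_le_of_geometric_bound_of_hasSum ((div_lt_one hρ0).mpr hrρ) (fun n => ?_) hsum M
  rw [← hcoef]
  refine (ContinuousMultilinearMap.le_opNorm _ _).trans ?_
  have hint : (2 * Real.pi)⁻¹ * ∫ θ : ℝ in 0..2 * Real.pi, ‖g (circleMap 0 ρ θ)‖ ≤ C := by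
    have h := intervalIntegral.norm_integral_le_of_norm_le_const (a := 0) (b := 2 * Real.pi)
      (f := fun θ => ‖g (circleMap 0 ρ θ)‖) (C := C) fun θ _ => by
        rw [norm_norm]
        refine hC _ (hball _ ?_)
        rw [norm_circleMap_zero, abs_of_pos hρ0]
        exact hρ
    rw [sub_zero, abs_of_pos Real.two_pi_pos] at h
    rw [inv_mul_le_iff₀ Real.two_pi_pos, mul_comm (2 * Real.pi)]
    exact (Real.le_norm_self _).trans h
  have hn := (norm_cauchyPowerSeries_le g 0 ρ n).trans
    (mul_le_mul_of_nonneg_right hint (by positivity))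
  rw [abs_of_pos hρ0] at hn
  calc _ ≤ C * (ρ : ℝ)⁻¹ ^ n * ∏ _i : Fin n, ‖(r : ℂ)‖ :=
        mul_le_mul_of_nonneg_right hn (by positivity)
    _ = C * (r / ρ) ^ n := by
        rw [Finset.prod_const, Complex.norm_real, Real.norm_of_nonneg hr, Finset.card_univ,
          Fintype.card_fin, mul_assoc, ← mul_pow, div_eq_inv_mul]

/-- Evaluation at a point of the ball. -/
def evalHom (x : UnitBall X) : Au X →ₐ[ℂ] ℂ where
  toFun f := (f : UnitBall X →ᵇ ℂ) x
  map_one' := rfl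
  map_mul' _ _ := rfl
  map_zero' := rfl
  map_add' _ _ := rfl
  commutes' _ := rfl

theorem norm_evalHom_le (x : UnitBall X) (f : Au X) : ‖evalHom x f‖ ≤ ‖f‖ :=
  (f : UnitBall X →ᵇ ℂ).norm_coe_le_norm x

theorem evalHom_sum_smul {κ : Type*} (x : UnitBall X) (s : Finset κ) (c : κ → ℂ) (G : κ → Au X) :
    evalHom x (∑ k ∈ s, c k • G k) = ∑ k ∈ s, c k * evalHom x (G k) :=
  (map_sum (evalHom x) _ s).trans rfl

theorem dist_le_of_forall_evalHom {f g : Au X} {C : ℝ} (hC : 0 ≤ C)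
    (h : ∀ x, dist (evalHom x f) (evalHom x g) ≤ C) : dist f g ≤ C :=
  (BoundedContinuousFunction.dist_le hC).mpr h

end General

/-! ### Density of the algebra generated by the functionals. -/

/-- Subalgebras containing the functionals contain the polynomials that factor through `proj n`. -/
theorem exists_mem_eq_proj (E : Subalgebra ℂ (Au ConvSeq))
    (hE : ∀ φ, dualToAu ConvSeq φ ∈ E) {m : ℕ}
    (A : ContinuousMultilinearMap ℂ (fun _ : Fin m => ConvSeq) ℂ) (n : ℕ) :
    ∃ G ∈ E, ∀ x : UnitBall ConvSeq, evalHom x G = A (fun _ => proj n x) := by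
  -- Multilinear expansion of `A` after writing `proj n x` in the vectors `projBasis n`; the
  -- coefficients are products of functionals.
  refine ⟨∑ κ : Fin m → Option (Fin n), A (fun i => projBasis n (κ i)) •
    ∏ i, dualToAu ConvSeq (eval ((κ i).map Fin.val)), ?_, fun x => ?_⟩
  · exact E.sum_mem fun κ _ => E.smul_mem (E.prod_mem fun i _ => hE _) _
  · simp only [proj]
    rw [evalHom_sum_smul, A.map_sum]
    refine Finset.sum_congr rfl fun κ _ => ?_
    rw [map_prod, A.map_smul_univ (fun i => eval ((κ i).map Fin.val) x.1) fun i => projBasis n (κ i),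
      smul_eq_mul, mul_comm]
    rfl

/-- Bounded uniformly continuous analytic functions on the ball of `c` are uniformly approximated
by polynomials that factor through the projections `proj n`. -/
theorem exists_proj_polynomial_approx (f : Au ConvSeq) {ε : ℝ} (hε : 0 < ε) :
    ∃ (M : ℕ) (c : ℕ → ℂ) (n : ℕ → ℕ) (p : FormalMultilinearSeries ℂ ConvSeq ℂ),
      ∀ x : UnitBall ConvSeq, dist (evalHom x f)
        (∑ m ∈ Finset.range M, c m * p m (fun _ => proj (n m) x)) ≤ 3 * ε := by
  obtain ⟨hfu, F, hF, hfF⟩ := f.2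
  replace hfF : ∀ x : UnitBall ConvSeq, evalHom x f = F x := hfF
  have hC : ∀ y ∈ Metric.ball (0 : ConvSeq) 1, ‖F y‖ ≤ ‖f‖ := fun y hy =>
    (congrArg norm (hfF ⟨y, hy⟩)).symm.trans_le (norm_evalHom_le ⟨y, hy⟩ f)
  generalize ‖f‖ = C at hC
  obtain ⟨p, hp⟩ := hF 0 (Metric.mem_ball_self one_pos)
  obtain ⟨δ, hδ, hfδ⟩ := Metric.uniformContinuous_iff.mp hfu ε hε
  -- The Taylor series is controlled only on smaller balls, hence the dilation by `r`; `r > 1 - δ`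
  -- keeps `r • x` within `δ` of `x`. The three errors of size `ε` come from dilation, the Taylor
  -- tail and the projections.
  obtain ⟨r, hr, hr1⟩ := exists_between (max_lt (show 1 - δ < 1 by linarith) one_pos)
  obtain ⟨hrδ, hr0⟩ := max_lt_iff.mp hr
  obtain ⟨ρ, hrρ, hρ⟩ := exists_between hr1
  have hq : r / ρ < 1 := (div_lt_one (hr0.trans hrρ)).mpr hrρ
  have hlim : Tendsto (fun M : ℕ => C * (r / ρ) ^ M / (1 - r / ρ)) atTop (𝓝 0) := by
    simpa using ((tendsto_pow_atTop_nhds_zero_of_lt_one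
      (div_nonneg hr0.le (hr0.trans hrρ).le) hq).const_mul C).div_const (1 - r / ρ)
  obtain ⟨M, hM⟩ := (hlim.eventually_lt_const hε).exists
  -- At most `ε` in total over the `M` degrees; `M + 1` keeps the denominator positive.
  choose n hn using fun m => exists_norm_sub_proj_le (p m) (show 0 < ε / (M + 1) by positivity)
  refine ⟨M, fun m => (r : ℂ) ^ m, n, p, fun x => ?_⟩
  have hx : ‖(x : ConvSeq)‖ < 1 := mem_ball_zero_iff.mp x.2
  have hrx : (r : ℂ) • (x : ConvSeq) ∈ Metric.ball (0 : ConvSeq) 1 := by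
    rw [mem_ball_zero_iff, norm_smul, Complex.norm_real, Real.norm_of_nonneg hr0.le]
    nlinarith [norm_nonneg (x : ConvSeq)]
  have h1 : dist (evalHom x f) (F ((r : ℂ) • (x : ConvSeq))) < ε := by
    have hd : dist x ⟨_, hrx⟩ < δ := by
      rw [Subtype.dist_eq, dist_eq_norm]
      have e : (x : ConvSeq) - (r : ℂ) • (x : ConvSeq) = ((1 - r : ℝ) : ℂ) • (x : ConvSeq) := by
        push_cast
        rw [sub_smul, one_smul]
      change ‖(x : ConvSeq) - (r : ℂ) • (x : ConvSeq)‖ < δ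
      rw [e, norm_smul, Complex.norm_real, Real.norm_of_nonneg (by linarith)]
      nlinarith [norm_nonneg (x : ConvSeq)]
    have : dist (evalHom x f) (evalHom ⟨_, hrx⟩ f) < ε := hfδ hd
    rwa [hfF ⟨_, hrx⟩] at this
  have h2 := norm_taylor_sub_le hF hC hp hr0.le hrρ hρ hx.le M
  rw [← dist_eq_norm, dist_comm] at h2
  have h3 : dist (∑ m ∈ Finset.range M, (r : ℂ) ^ m * p m (fun _ => (x : ConvSeq)))
      (∑ m ∈ Finset.range M, (r : ℂ) ^ m * p m (fun _ => proj (n m) x)) ≤ ε := by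
    rw [dist_eq_norm, ← Finset.sum_sub_distrib]
    refine (norm_sum_le_of_le (Finset.range M) (n := fun _ => ε / (M + 1)) fun m _ => ?_).trans ?_
    · rw [← mul_sub, norm_mul, norm_pow, Complex.norm_real, Real.norm_of_nonneg hr0.le]
      exact (mul_le_of_le_one_left (norm_nonneg _) (pow_le_one₀ hr0.le hr1.le)).trans
        (hn m x hx.le)
    · rw [Finset.sum_const, Finset.card_range, nsmul_eq_mul, mul_div_assoc',
        div_le_iff₀ (by positivity)]
      nlinarith
  have h4 := dist_triangle4 (evalHom x f) (F ((r : ℂ) • (x : ConvSeq)))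
    (∑ m ∈ Finset.range M, (r : ℂ) ^ m * p m (fun _ => (x : ConvSeq)))
    (∑ m ∈ Finset.range M, (r : ℂ) ^ m * p m (fun _ => proj (n m) x))
  linarith

/-- The functionals on `c` generate `A_u(B)` as a closed algebra. -/
theorem mem_of_isClosed_of_dual_mem (E : Subalgebra ℂ (Au ConvSeq))
    (hcl : IsClosed (E : Set (Au ConvSeq))) (hE : ∀ φ, dualToAu ConvSeq φ ∈ E)
    (f : Au ConvSeq) : f ∈ E := by
  refine hcl.closure_subset (Metric.mem_closure_iff.mpr fun ε hε => ?_)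
  obtain ⟨M, c, n, p, h⟩ := exists_proj_polynomial_approx f (show 0 < ε / 4 by positivity)
  choose G hGE hG using fun m => exists_mem_eq_proj E hE (p m) (n m)
  refine ⟨∑ m ∈ Finset.range M, c m • G m, E.sum_mem fun m _ => E.smul_mem (hGE m) _, ?_⟩
  refine (dist_le_of_forall_evalHom (C := 3 * (ε / 4)) (by positivity) fun x => ?_).trans_lt
    (by linarith)
  rw [evalHom_sum_smul, Finset.sum_congr rfl fun m _ => by rw [hG m x]]
  exact h x

/-! ### Goldstine's theorem and characters from ultrafilters. -/

section General

variable {X : Type*} [NormedAddCommGroup X] [NormedSpace ℂ X]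

/-- The ball is invariant under multiplication by phases, so `x` can be rotated until `φ x` equals
its norm. -/
theorem norm_le_of_forall_re_lt {φ : StrongDual ℂ X} {u : ℝ}
    (h : ∀ x : UnitBall X, (φ x).re < u) : ‖φ‖ ≤ u := by
  rw [← ContinuousLinearMap.sSup_unit_ball_eq_norm]
  refine csSup_le ((Metric.nonempty_ball.mpr one_pos).image _) ?_
  rintro _ ⟨x, hx, rfl⟩
  by_cases h0 : φ x = 0
  · have := h ⟨0, Metric.mem_ball_self one_pos⟩
    simp only [map_zero, Complex.zero_re] at this
    simpa [h0] using this.le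
  · have hn : ‖(‖φ x‖ : ℂ) / φ x‖ = 1 := by
      rw [norm_div, Complex.norm_real, norm_norm, div_self (norm_ne_zero_iff.mpr h0)]
    have := h ⟨((‖φ x‖ : ℂ) / φ x) • x, by
      rw [mem_ball_zero_iff, norm_smul, hn, one_mul]; exact mem_ball_zero_iff.mp hx⟩
    simp only [map_smul, smul_eq_mul, div_mul_cancel₀ _ h0, Complex.ofReal_re] at this
    exact this.le

theorem isScalarTower_weakDual : IsScalarTower ℝ ℂ (WeakDual ℂ X) :=
  inferInstanceAs (IsScalarTower ℝ ℂ (StrongDual ℂ X))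

theorem locallyConvexSpace_weakDual : LocallyConvexSpace ℝ (WeakDual ℂ X) :=
  @WeakBilin.locallyConvexSpace ℂ (StrongDual ℂ X) X _ _ _ _ _ _ _ _ _

/-- In Goldstine's theorem this turns the separating functional on the bidual into an element of the
dual. -/
theorem exists_eq_eval_of_weakDual (g : StrongDual ℂ (WeakDual ℂ X)) : ∃ x : X, ∀ φ, g φ = φ x := by
  obtain ⟨x, hx⟩ := LinearMap.dualEmbedding_surjective (topDualPairing ℂ X) g
  exact ⟨x, fun φ => (DFunLike.congr_fun hx φ).symm⟩

variable (X) in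
/-- The canonical embedding of the ball of `X` into the bidual with the weak-star topology. -/
def ballToBidual (x : UnitBall X) : WeakDual ℂ (StrongDual ℂ X) :=
  StrongDual.toWeakDual (NormedSpace.inclusionInDoubleDual ℂ X x)

theorem convex_range_ballToBidual : Convex ℝ (Set.range (ballToBidual X)) := by
  rintro _ ⟨x, rfl⟩ _ ⟨y, rfl⟩ a b ha hb hab
  refine ⟨⟨a • x.1 + b • y.1, convex_ball (0 : X) 1 x.2 y.2 ha hb hab⟩, ?_⟩
  refine ContinuousLinearMap.ext fun φ => ?_
  change φ (a • x.1 + b • y.1) = a • φ x.1 + b • φ y.1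
  rw [map_add, φ.map_smul_of_tower, φ.map_smul_of_tower]

/-- Goldstine's theorem for the open unit ball. -/
theorem mem_closure_range_ballToBidual {z : StrongDual ℂ (StrongDual ℂ X)} (hz : ‖z‖ ≤ 1) :
    StrongDual.toWeakDual z ∈ closure (Set.range (ballToBidual X)) := by
  by_contra hcon
  have := isScalarTower_weakDual (X := StrongDual ℂ X)
  have := locallyConvexSpace_weakDual (X := StrongDual ℂ X)
  -- Separation yields `φ` with `‖φ‖ ≤ u < Re (z φ)`, against `‖z‖ ≤ 1`.
  obtain ⟨g, u, hg, hgz⟩ := RCLike.geometric_hahn_banach_closed_point (𝕜 := ℂ)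
    convex_range_ballToBidual.closure isClosed_closure hcon
  obtain ⟨φ, hφ⟩ := exists_eq_eval_of_weakDual g
  have h1 : ‖φ‖ ≤ u := norm_le_of_forall_re_lt fun x => by
    have := hg _ (subset_closure ⟨x, rfl⟩)
    rwa [hφ] at this
  have h2 : u < (z φ).re := by rwa [hφ] at hgz
  have h3 := (Complex.re_le_norm (z φ)).trans (z.le_of_opNorm_le hz φ)
  linarith

/-- Limits along an ultrafilter on the ball are characters of `A_u(B)`. -/
theorem exists_character_tendsto (l : Ultrafilter (UnitBall X)) :
    ∃ τ : WeakDual.characterSpace ℂ (Au X),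
      ∀ f : Au X, Tendsto (fun x => evalHom x f) l (𝓝 (τ f)) := by
  have hex : ∀ f : Au X, ∃ a, ‖a‖ ≤ ‖f‖ ∧ Tendsto (fun x => evalHom x f) l (𝓝 a) := fun f => by
    obtain ⟨a, ha, hla⟩ := (isCompact_closedBall (0 : ℂ) ‖f‖).ultrafilter_le_nhds
      (l.map fun x => evalHom x f) (le_principal_iff.mpr (mem_map.mpr (Eventually.of_forall
        fun x => mem_closedBall_zero_iff.mpr (norm_evalHom_le x f))))
    exact ⟨a, mem_closedBall_zero_iff.mp ha, hla⟩
  choose L hLn hL using hex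
  have hadd : ∀ f g, L (f + g) = L f + L g := fun f g =>
    tendsto_nhds_unique (hL (f + g)) ((hL f).add (hL g))
  have hsmul : ∀ (c : ℂ) f, L (c • f) = c • L f := fun c f =>
    tendsto_nhds_unique (hL (c • f)) ((hL f).const_smul c)
  have hmul : ∀ f g, L (f * g) = L f * L g := fun f g =>
    tendsto_nhds_unique (hL (f * g)) ((hL f).mul (hL g))
  have hone : L 1 = 1 := tendsto_nhds_unique (hL 1) tendsto_const_nhds
  let Λ : StrongDual ℂ (Au X) := LinearMap.mkContinuous
    { toFun := L, map_add' := hadd, map_smul' := hsmul } 1 fun f => by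
      rw [one_mul]; exact hLn f
  refine ⟨⟨StrongDual.toWeakDual Λ, fun h => ?_, hmul⟩, hL⟩
  have h1 : L 1 = 0 := DFunLike.congr_fun h 1
  exact one_ne_zero (hone.symm.trans h1)

theorem mem_fiber_of_tendsto {l : Filter (UnitBall X)} [l.NeBot]
    {z : StrongDual ℂ (StrongDual ℂ X)}
    (hl : Tendsto (ballToBidual X) l (𝓝 (StrongDual.toWeakDual z)))
    {τ : WeakDual.characterSpace ℂ (Au X)}
    (hτ : ∀ f : Au X, Tendsto (fun x => evalHom x f) l (𝓝 (τ f))) : τ ∈ fiber z := by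
  refine ContinuousLinearMap.ext fun φ => ?_
  exact tendsto_nhds_unique (hτ (dualToAu X φ)) (((WeakDual.eval_continuous φ).tendsto _).comp hl)

end General

/-! ### Fibers and cluster values. -/

/-- Two characters over `z` agree on a closed subalgebra containing all functionals, which is all of
`A_u(B)`. -/
theorem fiber_subsingleton (z : StrongDual ℂ (StrongDual ℂ ConvSeq)) :
    (fiber z).Subsingleton := by
  intro τ hτ σ hσ
  let E : Subalgebra ℂ (Au ConvSeq) := AlgHom.equalizer
    (WeakDual.CharacterSpace.toAlgHom τ) (WeakDual.CharacterSpace.toAlgHom σ)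
  have hcl : IsClosed (E : Set (Au ConvSeq)) :=
    isClosed_eq (WeakDual.CharacterSpace.toCLM τ).continuous
      (WeakDual.CharacterSpace.toCLM σ).continuous
  have hE : ∀ φ, dualToAu ConvSeq φ ∈ E := fun φ =>
    DFunLike.congr_fun (Eq.trans hτ (Eq.symm hσ)) φ
  exact WeakDual.CharacterSpace.ext fun f => mem_of_isClosed_of_dual_mem E hcl hE f

/-- The cluster value theorem holds at every point of the closed unit ball of the bidual over which
the fiber has at most one point, and such a fiber is not empty. -/
theorem clusterValueTheoremAt_of_fiber_subsingleton {X : Type*} [NormedAddCommGroup X]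
    [NormedSpace ℂ X] {z : StrongDual ℂ (StrongDual ℂ X)} (hz : ‖z‖ ≤ 1)
    (hs : (fiber z).Subsingleton) : ClusterValueTheoremAt z ∧ ∃ τ, fiber z = {τ} := by
  have hne : (comap (ballToBidual X) (𝓝 (StrongDual.toWeakDual z))).NeBot :=
    comap_neBot fun t ht => by
      obtain ⟨_, hxt, x, rfl⟩ :=
        mem_closure_iff_nhds.mp (mem_closure_range_ballToBidual hz) t ht
      exact ⟨x, hxt⟩
  obtain ⟨l, hl⟩ := Ultrafilter.exists_le (comap (ballToBidual X) (𝓝 (StrongDual.toWeakDual z)))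
  replace hl := tendsto_comap.mono_left hl
  obtain ⟨τ, hτ⟩ := exists_character_tendsto l
  have hτz : τ ∈ fiber z := mem_fiber_of_tendsto hl hτ
  refine ⟨fun f => Set.Subset.antisymm ?_ ?_, τ, hs.eq_singleton_of_mem hτz⟩
  · rintro a ⟨l, hlne, hlz, hla⟩
    obtain ⟨σ, hσ⟩ := exists_character_tendsto (Ultrafilter.of l)
    exact ⟨σ, mem_fiber_of_tendsto (hlz.mono_left (Ultrafilter.of_le l)) hσ,
      tendsto_nhds_unique (hσ f) (hla.mono_left (Ultrafilter.of_le l))⟩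
  · rintro _ ⟨σ, hσ, rfl⟩
    -- Uniqueness identifies `σ` with the limit character `τ`, whose values are attained along `l`.
    rw [hs hσ hτz]
    exact ⟨l, inferInstance, hl, hτ f⟩

end ClusterValue

end

theorem corollary2
    (z : StrongDual ℂ (StrongDual ℂ ClusterValue.ConvSeq)) (hz : z ∈ Metric.closedBall 0 1) :
    ClusterValue.ClusterValueTheoremAt z ∧ ∃ τ, ClusterValue.fiber z = {τ} := by
  exact ClusterValue.clusterValueTheoremAt_of_fiber_subsingleton
    ((dist_zero_right z).symm.trans_le (Metric.mem_closedBall.mp hz))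
    (ClusterValue.fiber_subsingleton z)
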